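/- Let $p$ be an odd prime, $n\ge 4$, $q=p^n$, $1\ne c\in\mathbb F_q$, let $L(x)=\sum_{i=0}^{n-1}a_ix^{p^i}$ with $a_i\in\mathbb F_q$, and let $G(x)=x^{p^n-2}+L(x)$ on $\mathbb F_q$. Let $\delta_{G,c}=\max_{a,b\in\mathbb F_q}\#\{x\in\mathbb F_q: G(x+a)-cG(x)=b\}$ be the $c$-differential uniformity of $G$. Let $s_1,\dots,s_k$ be the indices $i\in\{0,\dots,n-1\}$ with $a_i\ne 0$, let $\delta=\gcd(s_1,\dots,s_k,n)$, and let $\chi_1(x)=\exp(2\pi i\,\mathrm{Tr}(x)/p)$, where $\mathrm{Tr}:\mathbb F_q\to\mathbb F_p$ is the absolute trace. For $\alpha\in\mathbb F_q$ let $N_\alpha$ be the number of $w\in\mathbb F_q$ with $$T_n(w)=2\alpha a_0w+\sum_{i=1}^{n-1}\left(\alpha a_i\,w^{p^i}+(\alpha a_iw)^{p^{-i}}\right)=0,$$ where $y\mapsto y^{p^{-i}}$ is the inverse of $y\mapsto y^{p^i}$ on $\mathbb F_q$. Put $N=\max_{\alpha\in\mathbb F_q}N_\alpha$. (i) $\delta_{G,c}\le\sqrt{p^nN}$,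 and also $\delta_{G,c}\le (pN)^{n/2}$. Moreover, for every $\alpha$, $N_\alpha=p^{\delta\gamma_\alpha}$ for some nonnegative integer $\gamma_\alpha$. (ii) Suppose that $n=2m$, $n/\delta$ is even, $2\delta\mid s_i-s_j$ for all $i,j$, $p^\delta+1>4$, and $p^\delta+1\mid p^{s_i}+1$ for all $i$. Then for every $\alpha\in\mathbb F_q$ the Weil sum $S_\alpha=\sum_{x\in\mathbb F_q}\chi_1(\alpha xL(x))=\sum_{x\in\mathbb F_q}\chi_1\big(\sum_i\alpha a_ix^{p^i+1}\big)$ is real, with $S_\alpha=\mu_\alpha\sqrt{qN_\alpha}$ for a sign $\mu_\alpha=\pm1$; the two expressions below are real, and $$\delta_{G,c}\ \ge\ \frac1{p^n}\sum_{\alpha\in\mathbb F_q}\chi_1(\alpha)\,\mu_\alpha\,p^{\delta\gamma_\alpha/2}.$$ Even more precisely, every $\gamma_\alpha$ is even and $$\delta_{G,c}\ \ge\ (-1)^{m/\delta}p^{-m}\sum_{\alpha\in\mathbb F_q,\ N_\alpha=1}\chi_1(\alpha)\ +\ (-1)^{m/\delta}p^{-m}\sum_{\alpha\in\mathbb F_q,\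 N_\alpha>1}\chi_1(\alpha)(-1)^{\gamma_\alpha/2}p^{\delta\gamma_\alpha/2}.$$ -/

import Mathlib

open Finset
open scoped ComplexOrder

/-- The entry `_cΔ_G(a,b) = #{x : G(x+a) - c G(x) = b}` of the `c`-difference distribution table. -/
noncomputable def cDDT {F : Type*} [Field F] [Fintype F] (G : F → F) (c a b : F) : ℕ :=
  Nat.card {x : F // G (x + a) - c * G x = b}

open Classical in
/-- The `c`-differential uniformity `δ_{G,c}`: the largest entry of the `c`-DDT over all `(a,b)`,
with `a ≠ 0` required only when `c = 1`. -/
noncomputable def cUniformity {F : Type*} [Field F] [Fintype F] (G : F → F) (c : F) : ℕ :=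
  ((univ : Finset (F × F)).filter (fun ab => c = 1 → ab.1 ≠ 0)).sup
    (fun ab => cDDT G c ab.1 ab.2)

/-- The linearized polynomial map `L(x) = ∑_{i<n} a_i x^{p^i}`. -/
def linPoly {F : Type*} [Field F] (p n : ℕ) (a : ℕ → F) (x : F) : F :=
  ∑ i ∈ range n, a i * x ^ p ^ i

/-- The perturbed inverse function `G(x) = x^{p^n-2} + L(x)`. -/
def perturbedInverse {F : Type*} [Field F] (p n : ℕ) (a : ℕ → F) (x : F) : F :=
  x ^ (p ^ n - 2) + linPoly p n a x

open Classical in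
/-- The indices `s_1, …, s_k`: those `i < n` with `a_i ≠ 0`. -/
noncomputable def supportIdx {F : Type*} [Field F] (n : ℕ) (a : ℕ → F) : Finset ℕ :=
  (range n).filter (fun i => a i ≠ 0)

/-- `δ = gcd(s_1, …, s_k, n)`. -/
noncomputable def deltaGcd {F : Type*} [Field F] (n : ℕ) (a : ℕ → F) : ℕ :=
  Nat.gcd ((supportIdx n a).gcd id) n

/-- `T_n(w) = 2αa_0 w + ∑_{i=1}^{n-1} (αa_i w^{p^i} + (αa_i w)^{p^{-i}})`. On a field with `p^n`
elements the inverse Frobenius power `y^{p^{-i}}` is `y^{p^{n-i}}`. -/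
def Tpoly {F : Type*} [Field F] (p n : ℕ) (a : ℕ → F) (α w : F) : F :=
  2 * (α * a 0) * w +
    ∑ i ∈ Ico 1 n, (α * a i * w ^ p ^ i + (α * a i * w) ^ p ^ (n - i))

/-- `N_α`, the number of zeros of `T_n` in the field. -/
noncomputable def numRoots {F : Type*} [Field F] [Fintype F] (p n : ℕ) (a : ℕ → F) (α : F) : ℕ :=
  Nat.card {w : F // Tpoly p n a α w = 0}

/-- `N = max_α N_α`, over all `α` in the field. -/
noncomputable def maxRoots {F : Type*} [Field F] [Fintype F] (p n : ℕ) (a : ℕ → F) : ℕ :=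
  (univ : Finset F).sup (numRoots p n a)

/-- The principal additive character `χ₁(x) = exp(2πi Tr(x)/p)`. -/
noncomputable def chiOne (p : ℕ) [Fact p.Prime] {F : Type*} [Field F] [Algebra (ZMod p) F]
    (x : F) : ℂ :=
  ZMod.stdAddChar (Algebra.trace (ZMod p) F x)

/-- The Weil sum `S_α = ∑_x χ₁(∑_i αa_i x^{p^i+1})` of the Dembowski–Ostrom polynomial
`α x L(x)`. -/
noncomputable def weilSum (p : ℕ) [Fact p.Prime] {F : Type*} [Field F] [Fintype F]
    [Algebra (ZMod p) F] (n : ℕ) (a : ℕ → F) (α : F) : ℂ :=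
  ∑ x : F, chiOne p (∑ i ∈ range n, α * a i * x ^ (p ^ i + 1))

/-- The technical condition: `n = 2m`, `n/δ` is even, `2δ ∣ s_i - s_j` for all `i, j`,
and `4 < p^δ + 1 ∣ p^{s_i} + 1` for all `i`. -/
def TechCond {F : Type*} [Field F] (p n m : ℕ) (a : ℕ → F) : Prop :=
  n = 2 * m ∧
  Even (n / deltaGcd n a) ∧
  (∀ s ∈ supportIdx n a, ∀ t ∈ supportIdx n a, (2 * (deltaGcd n a : ℤ)) ∣ (s : ℤ) - (t : ℤ)) ∧
  4 < p ^ deltaGcd n a + 1 ∧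
  ∀ s ∈ supportIdx n a, p ^ deltaGcd n a + 1 ∣ p ^ s + 1

/-!
The argument runs through the quadratic form `x ↦ Tr(αxL(x))` on `F`, whose exponential sum is the
Weil sum `S_α`. Its polar form is represented by `T_n` with respect to the trace form
(`trace_polar`), so `N_α` is the size of the radical, and squaring the sum gives `|S_α|² = qN_α`
(`weilSum_mul_conj`). For `i` in the support `x ↦ x^{p^i}` is linear over the field with `p^δ`
elements, hence `N_α` is a power of `p^δ` (`exists_numRoots_eq_pow_deltaGcd`).

The upper bounds hold because the maximum `N` includes `α = 0`, where `T_n` vanishes identically: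
thus `N = q` (`maxRoots_eq_card`), and both bounds are at least `q`, the size of the field.

Under the technical condition every exponent of the support is an odd multiple of `δ`, and the form
is Hermitian for the quadratic extension of the field with `Q = p^δ` elements. So the radical is a
vector space over the field with `Q²` elements and `γ_α` is even (`TechCond.even_of_numRoots_eq`).
Multiplication by an element `u` with `u^{Q+1} = -1` negates the form, so `S_α` is real, and
therefore `S_α = ±Q^{m/δ + γ_α/2}`. The sign follows from a congruence (`TechCond.weilSum_eq`): on
nonzero `x` the form depends only on `x^{Q+1}`, whose fibres have `Q + 1` elements, so `S_α ≡ 1`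
modulo `Q + 1` in the ring of algebraic integers. As `Q ≡ -1` and `Q + 1 > 2`, the sign is
`(-1)^{m/δ + γ_α/2}`.

For the lower bounds, `q⁻¹ ∑_α χ₁(α) S_α` is the number of solutions of `xL(x) = -1`
(`sum_chiOne_mul_weilSum`), and each of these is a root of `G`, so it is counted by the entry
`(0, 0)` of the `c`-difference distribution table (`card_le_cUniformity`). The second lower bound is
exactly this number, and the first is this number divided by `p^m`.
-/

/-! ### The additive character and the trace -/

/-- The principal additive character `chiOne` as a bundled additive character of `F`. -/
noncomputable def chiAddChar (p : ℕ) [Fact p.Prime] (F : Type*) [Field F]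
    [Algebra (ZMod p) F] : AddChar F ℂ :=
  (ZMod.stdAddChar (N := p)).compAddMonoidHom (Algebra.trace (ZMod p) F).toAddMonoidHom

theorem chiOne_eq_chiAddChar (p : ℕ) [Fact p.Prime] {F : Type*} [Field F] [Algebra (ZMod p) F]
    (x : F) : chiOne p x = chiAddChar p F x := rfl

theorem chiAddChar_isPrimitive (p : ℕ) [Fact p.Prime] {F : Type*} [Field F] [Fintype F]
    [Algebra (ZMod p) F] : (chiAddChar p F).IsPrimitive := by
  apply AddChar.IsPrimitive.of_ne_one
  intro h
  obtain ⟨x, hx⟩ := Algebra.trace_surjective (ZMod p) F 1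
  have h1 : chiAddChar p F x = 1 := by rw [h]; rfl
  have h2 : ZMod.stdAddChar (N := p) 1 = ZMod.stdAddChar (N := p) 0 := by
    rw [AddChar.map_zero_eq_one, ← hx]
    exact h1
  exact one_ne_zero (ZMod.injective_stdAddChar h2)

theorem isIntegral_chiAddChar (p : ℕ) [Fact p.Prime] {F : Type*} [Field F] [Algebra (ZMod p) F]
    (x : F) : IsIntegral ℤ (chiAddChar p F x) := by
  have hp : p ≠ 0 := (Fact.out : p.Prime).ne_zero
  have : CharP F p := charP_of_injective_algebraMap (algebraMap (ZMod p) F).injective p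
  apply IsIntegral.of_pow (Nat.pos_of_ne_zero hp)
  rw [← AddChar.map_nsmul_eq_pow, nsmul_eq_mul, CharP.cast_eq_zero, zero_mul,
    AddChar.map_zero_eq_one]
  exact isIntegral_one

theorem trace_pow_prime_pow (p : ℕ) [Fact p.Prime] {F : Type*} [Field F] [Fintype F]
    [Algebra (ZMod p) F] (k : ℕ) (x : F) :
    Algebra.trace (ZMod p) F (x ^ p ^ k) = Algebra.trace (ZMod p) F x := by
  induction k with
  | zero => simp
  | succ k ih =>
    rw [pow_succ, pow_mul, ← ih]
    have := Algebra.trace_eq_of_algEquiv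
      (FiniteField.frobeniusAlgEquivOfAlgebraic (ZMod p) F) (x ^ p ^ k)
    rwa [FiniteField.coe_frobeniusAlgEquivOfAlgebraic, ZMod.card] at this

/-- Orthogonality: `∑_x χ₁(x b)` detects `b = 0`. -/
theorem sum_chiAddChar_mul (p : ℕ) [Fact p.Prime] {F : Type*} [Field F] [Fintype F]
    [Algebra (ZMod p) F] (b : F) [Decidable (b = 0)] :
    ∑ x : F, chiAddChar p F (x * b) = if b = 0 then (Fintype.card F : ℂ) else 0 := by
  classical
  rw [AddChar.sum_mulShift b (chiAddChar_isPrimitive p)]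
  split_ifs <;> simp

/-! ### Linearized polynomials and the polar form -/

theorem linPoly_add (p : ℕ) [Fact p.Prime] {F : Type*} [Field F] [Algebra (ZMod p) F]
    (n : ℕ) (a : ℕ → F) (x y : F) :
    linPoly p n a (x + y) = linPoly p n a x + linPoly p n a y := by
  have : CharP F p := charP_of_injective_algebraMap (algebraMap (ZMod p) F).injective p
  simp only [linPoly, add_pow_char_pow, mul_add, sum_add_distrib]

/-- The argument `∑ αa_i x^{p^i+1}` of the character in the Weil sum is `αxL(x)`. -/
theorem weil_argument (p : ℕ) {F : Type*} [Field F] (n : ℕ) (a : ℕ → F) (α x : F) :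
    ∑ i ∈ range n, α * a i * x ^ (p ^ i + 1) = α * (x * linPoly p n a x) := by
  simp only [linPoly, mul_sum]
  exact sum_congr rfl fun i _ => by ring

theorem Tpoly_add (p : ℕ) [Fact p.Prime] {F : Type*} [Field F] [Algebra (ZMod p) F]
    (n : ℕ) (a : ℕ → F) (α x y : F) :
    Tpoly p n a α (x + y) = Tpoly p n a α x + Tpoly p n a α y := by
  have : CharP F p := charP_of_injective_algebraMap (algebraMap (ZMod p) F).injective p
  simp only [Tpoly, add_pow_char_pow, mul_add, sum_add_distrib]
  ring

/-- `T_n` represents the polar form of `x ↦ Tr(αxL(x))` with respect to the trace form. -/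
theorem trace_polar (p : ℕ) [Fact p.Prime] {F : Type*} [Field F] [Fintype F] [Algebra (ZMod p) F]
    {n : ℕ} (hn : 0 < n) (hF : Fintype.card F = p ^ n) (a : ℕ → F) (α x y : F) :
    Algebra.trace (ZMod p) F (α * (y * linPoly p n a x + x * linPoly p n a y)) =
      Algebra.trace (ZMod p) F (y * Tpoly p n a α x) := by
  have key : ∀ i ∈ Ico 1 n, Algebra.trace (ZMod p) F (α * (x * (a i * y ^ p ^ i))) =
      Algebra.trace (ZMod p) F (y * (α * a i * x) ^ p ^ (n - i)) := by
    intro i hi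
    rw [mem_Ico] at hi
    -- the trace is invariant under the `p^{n-i}`-th power, which turns `y^{p^i}` into `y^q = y`
    rw [← trace_pow_prime_pow p (n - i) (α * (x * (a i * y ^ p ^ i)))]
    congr 1
    have hy : (y ^ p ^ i) ^ p ^ (n - i) = y := by
      rw [← pow_mul, ← pow_add, Nat.add_sub_cancel' hi.2.le, ← hF, FiniteField.pow_card]
    rw [show α * (x * (a i * y ^ p ^ i)) = (α * a i * x) * y ^ p ^ i by ring, mul_pow, hy]
    ring
  have hlin : ∀ z w : F, α * (w * linPoly p n a z) =
      α * a 0 * z * w + ∑ i ∈ Ico 1 n, α * (w * (a i * z ^ p ^ i)) := by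
    intro z w
    rw [linPoly, range_eq_Ico, sum_eq_sum_Ico_succ_bot hn, mul_add, mul_add, mul_sum, mul_sum]
    simp only [pow_zero, pow_one]
    congr 1
    ring
  rw [mul_add, hlin, hlin, Tpoly, mul_add, mul_sum]
  simp only [mul_add, sum_add_distrib, map_add, map_sum]
  rw [sum_congr rfl key]
  have h1 : ∀ i, α * (y * (a i * x ^ p ^ i)) = y * (α * a i * x ^ p ^ i) := fun i => by ring
  simp only [h1]
  rw [show y * (2 * (α * a 0) * x) = α * a 0 * x * y + α * a 0 * y * x by ring, map_add]
  ring

/-- The quadratic form `Tr(αxL(x))` vanishes on the kernel of `T_n`, the characteristic being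
odd. -/
theorem trace_eq_zero_of_Tpoly_eq_zero (p : ℕ) [Fact p.Prime] (hp : Odd p) {F : Type*} [Field F]
    [Fintype F] [Algebra (ZMod p) F] {n : ℕ} (hn : 0 < n) (hF : Fintype.card F = p ^ n)
    (a : ℕ → F) (α w : F) (hw : Tpoly p n a α w = 0) :
    Algebra.trace (ZMod p) F (α * (w * linPoly p n a w)) = 0 := by
  have h := trace_polar p hn hF a α w w
  rw [hw, mul_zero, map_zero, mul_add, map_add, ← two_mul] at h
  have h2 : (2 : ZMod p) ≠ 0 := by
    have : ((2 : ℕ) : ZMod p) ≠ 0 := by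
      rw [Ne, ZMod.natCast_eq_zero_iff, Nat.prime_dvd_prime_iff_eq Fact.out Nat.prime_two]
      rintro rfl
      exact absurd hp (by decide)
    exact_mod_cast this
  exact (mul_eq_zero.mp h).resolve_left h2

/-! ### The absolute value of the Weil sum -/

theorem weilSum_eq (p : ℕ) [Fact p.Prime] {F : Type*} [Field F] [Fintype F] [Algebra (ZMod p) F]
    (n : ℕ) (a : ℕ → F) (α : F) :
    weilSum p n a α = ∑ x : F, chiAddChar p F (α * (x * linPoly p n a x)) := by
  simp only [weilSum, weil_argument, chiOne_eq_chiAddChar]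

/-- The modulus of the Weil sum: `|S_α|² = q N_α`. Expanding the square and shifting one variable
by `w` leaves the inner sum `∑_y χ₁(y T_n(w))`, which is `q` on the kernel of `T_n` and vanishes
elsewhere. -/
theorem weilSum_mul_conj (p : ℕ) [Fact p.Prime] (hp : Odd p) {F : Type*} [Field F]
    [Fintype F] [Algebra (ZMod p) F] {n : ℕ} (hn : 0 < n) (hF : Fintype.card F = p ^ n)
    (a : ℕ → F) (α : F) :
    weilSum p n a α * (starRingEnd ℂ) (weilSum p n a α) = (p : ℂ) ^ n * numRoots p n a α := by
  classical
  have expand : ∀ w y : F, chiAddChar p F (α * ((w + y) * linPoly p n a (w + y))) *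
      chiAddChar p F (-(α * (y * linPoly p n a y))) =
      chiAddChar p F (α * (w * linPoly p n a w)) * chiAddChar p F (y * Tpoly p n a α w) := by
    intro w y
    have hpol : chiAddChar p F (y * Tpoly p n a α w) =
        chiAddChar p F (α * (y * linPoly p n a w + w * linPoly p n a y)) := by
      simp only [chiAddChar, AddChar.compAddMonoidHom_apply, LinearMap.toAddMonoidHom_coe,
        trace_polar p hn hF]
    rw [hpol, ← AddChar.map_add_eq_mul, ← AddChar.map_add_eq_mul, linPoly_add]
    congr 1
    ring
  have hker : ∀ w : F, chiAddChar p F (α * (w * linPoly p n a w)) *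
      (if Tpoly p n a α w = 0 then (Fintype.card F : ℂ) else 0) =
      if Tpoly p n a α w = 0 then (Fintype.card F : ℂ) else 0 := by
    intro w
    split_ifs with h
    · have : chiAddChar p F (α * (w * linPoly p n a w)) = 1 := by
        rw [chiAddChar, AddChar.compAddMonoidHom_apply, LinearMap.toAddMonoidHom_coe,
          trace_eq_zero_of_Tpoly_eq_zero p hp hn hF a α w h, AddChar.map_zero_eq_one]
      rw [this, one_mul]
    · rw [mul_zero]
  calc weilSum p n a α * (starRingEnd ℂ) (weilSum p n a α)
      = ∑ y : F, ∑ x : F, chiAddChar p F (α * (x * linPoly p n a x)) *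
          chiAddChar p F (-(α * (y * linPoly p n a y))) := by
        rw [weilSum_eq, map_sum, sum_mul_sum, sum_comm]
        simp only [AddChar.map_neg_eq_conj]
    _ = ∑ y : F, ∑ w : F, chiAddChar p F (α * ((w + y) * linPoly p n a (w + y))) *
          chiAddChar p F (-(α * (y * linPoly p n a y))) :=
        sum_congr rfl fun y _ => (Equiv.sum_comp (Equiv.addRight y) fun x =>
          chiAddChar p F (α * (x * linPoly p n a x)) *
          chiAddChar p F (-(α * (y * linPoly p n a y)))).symm
    _ = ∑ w : F, chiAddChar p F (α * (w * linPoly p n a w)) *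
          ∑ y : F, chiAddChar p F (y * Tpoly p n a α w) := by
        simp only [expand]
        rw [sum_comm]
        simp only [mul_sum]
    _ = (p : ℂ) ^ n * numRoots p n a α := by
        simp only [sum_chiAddChar_mul, hker]
        rw [← sum_filter, sum_const, nsmul_eq_mul, numRoots, Nat.card_eq_fintype_card,
          Fintype.card_subtype, hF, mul_comm]
        push_cast
        rfl

/-! ### The kernel of `T_n` as a vector space over a subfield -/

/-- If `u^{p^i} = u^{p^{-i}} = v` for every `i` in the support, then `T_n(uw) = v T_n(w)`. -/
theorem Tpoly_mul {p : ℕ} {F : Type*} [Field F] {n : ℕ} {a : ℕ → F} {α u v : F} (w : F)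
    (h0 : a 0 ≠ 0 → u = v)
    (h : ∀ i ∈ Ico 1 n, a i ≠ 0 → u ^ p ^ i = v ∧ u ^ p ^ (n - i) = v) (hp : p ≠ 0) :
    Tpoly p n a α (u * w) = v * Tpoly p n a α w := by
  rw [Tpoly, Tpoly, mul_add, mul_sum]
  congr 1
  · by_cases ha : a 0 = 0
    · simp [ha]
    · rw [h0 ha]; ring
  · refine sum_congr rfl fun i hi => ?_
    by_cases ha : a i = 0
    · simp [ha, hp]
    · obtain ⟨h1, h2⟩ := h i hi ha
      rw [show α * a i * (u * w) = u * (α * a i * w) by ring, mul_pow, mul_pow, h1, h2]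
      ring

/-- If the kernel of `T_n` is stable under multiplication by the subfield with `p^d` elements,
then its cardinality is a power of `p^d`. -/
theorem exists_numRoots_eq_pow (p : ℕ) [Fact p.Prime] {F : Type*} [Field F] [Fintype F]
    [Algebra (ZMod p) F] {n : ℕ} (hF : Fintype.card F = p ^ n) (a : ℕ → F) (α : F)
    {d : ℕ} (hd : d ≠ 0) (hdn : d ∣ n)
    (h : ∀ u w : F, u ^ p ^ d = u → Tpoly p n a α w = 0 → Tpoly p n a α (u * w) = 0) :
    ∃ k : ℕ, numRoots p n a α = p ^ (d * k) := by
  classical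
  have hfin : Module.finrank (ZMod p) F = n := by
    have := Module.card_eq_pow_finrank (K := ZMod p) (V := F)
    rw [hF, ZMod.card] at this
    exact (Nat.pow_right_injective (Fact.out : p.Prime).two_le this).symm
  obtain ⟨f⟩ : Nonempty (GaloisField p d →ₐ[ZMod p] F) :=
    FiniteField.nonempty_algHom_of_finrank_dvd (by rwa [GaloisField.finrank p hd, hfin])
  let _ : Algebra (GaloisField p d) F := f.toRingHom.toAlgebra
  let K : Submodule (GaloisField p d) F :=
    { carrier := {w | Tpoly p n a α w = 0}
      add_mem' := fun {x y} hx hy => by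
        change Tpoly p n a α (x + y) = 0
        change Tpoly p n a α x = 0 at hx
        change Tpoly p n a α y = 0 at hy
        rw [Tpoly_add, hx, hy, add_zero]
      zero_mem' := by
        have := Tpoly_add p n a α 0 0
        simpa using this
      smul_mem' := fun c x hx => by
        rw [Algebra.smul_def]
        refine h _ _ ?_ hx
        rw [← map_pow, ← GaloisField.card p d hd]
        have : Fintype (GaloisField p d) := Fintype.ofFinite _
        rw [Nat.card_eq_fintype_card, FiniteField.pow_card] }
  refine ⟨Module.finrank (GaloisField p d) K, ?_⟩
  rw [pow_mul, ← GaloisField.card p d hd, ← Module.natCard_eq_pow_finrank]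
  rfl

theorem deltaGcd_dvd {F : Type*} [Field F] (n : ℕ) (a : ℕ → F) : deltaGcd n a ∣ n :=
  Nat.gcd_dvd_right _ _

theorem deltaGcd_dvd_of_ne_zero {F : Type*} [Field F] {n : ℕ} {a : ℕ → F} {i : ℕ} (hi : i < n)
    (ha : a i ≠ 0) : deltaGcd n a ∣ i :=
  (Nat.gcd_dvd_left _ _).trans
    (Finset.gcd_dvd (f := id) (by simp [supportIdx, hi, ha] : i ∈ supportIdx n a))

theorem deltaGcd_ne_zero {F : Type*} [Field F] {n : ℕ} (hn : n ≠ 0) (a : ℕ → F) :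
    deltaGcd n a ≠ 0 := fun h => hn (Nat.eq_zero_of_gcd_eq_zero_right h)

theorem pow_pow_mul_of_pow_eq_self {M : Type*} [Monoid M] {p d : ℕ} {u : M} (hu : u ^ p ^ d = u)
    (k : ℕ) : u ^ p ^ (d * k) = u := by
  induction k with
  | zero => simp
  | succ k ih => rw [mul_add, mul_one, pow_add, pow_mul, ih, hu]

theorem pow_pow_mul_odd {M : Type*} [Monoid M] {p d : ℕ} {u : M} (hu : u ^ p ^ (2 * d) = u)
    {r : ℕ} (hr : Odd r) : u ^ p ^ (d * r) = u ^ p ^ d := by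
  obtain ⟨k, rfl⟩ := hr
  rw [show d * (2 * k + 1) = 2 * d * k + d by ring, pow_add, pow_mul,
    pow_pow_mul_of_pow_eq_self hu]

/-- `T_n` is linear over the subfield with `p^δ` elements, so `N_α` is a power of `p^δ`. -/
theorem exists_numRoots_eq_pow_deltaGcd (p : ℕ) [Fact p.Prime] {F : Type*} [Field F] [Fintype F]
    [Algebra (ZMod p) F] {n : ℕ} (hn : n ≠ 0) (hF : Fintype.card F = p ^ n) (a : ℕ → F) (α : F) :
    ∃ k : ℕ, numRoots p n a α = p ^ (deltaGcd n a * k) := by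
  refine exists_numRoots_eq_pow p hF a α (deltaGcd_ne_zero hn a) (deltaGcd_dvd n a) ?_
  intro u w hu hw
  rw [Tpoly_mul (v := u) w (fun _ => rfl) ?_ (Fact.out : p.Prime).ne_zero, hw, mul_zero]
  intro i hi ha
  rw [mem_Ico] at hi
  obtain ⟨r, hr⟩ := deltaGcd_dvd_of_ne_zero hi.2 ha
  obtain ⟨t, ht⟩ := (Nat.dvd_sub (deltaGcd_dvd n a) ⟨r, hr⟩ : deltaGcd n a ∣ n - i)
  rw [ht]
  exact ⟨by rw [hr]; exact pow_pow_mul_of_pow_eq_self hu r, pow_pow_mul_of_pow_eq_self hu t⟩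

/-! ### The Hermitian case -/

theorem odd_of_pow_add_one_dvd {Q r : ℕ} (hQ : 2 < Q + 1) (h : Q + 1 ∣ Q ^ r + 1) : Odd r := by
  rw [← Nat.not_even_iff_odd]
  intro hr
  -- modulo `Q + 1`, an even power of `Q ≡ -1` is `1`
  have h1 : (((Q + 1 : ℕ) : ℤ)) ∣ (Q : ℤ) ^ r - (-1) ^ r := by
    have := sub_dvd_pow_sub_pow (Q : ℤ) (-1) r
    push_cast
    simpa using this
  rw [hr.neg_one_pow] at h1
  have h2 : (((Q + 1 : ℕ) : ℤ)) ∣ (Q : ℤ) ^ r + 1 := by exact_mod_cast h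
  have h3 : (((Q + 1 : ℕ) : ℤ)) ∣ 2 := by
    have := dvd_sub h2 h1
    rwa [show (Q : ℤ) ^ r + 1 - (Q ^ r - 1) = 2 by ring] at this
  have := Int.le_of_dvd (by norm_num) h3
  omega

/-- Under the technical condition every index of the support is an odd multiple of `δ`, below an
even multiple `n` of `δ`. -/
theorem TechCond.exists_odd {p n m : ℕ} {F : Type*} [Field F] {a : ℕ → F}
    (h : TechCond p n m a) {i : ℕ} (hi : i < n) (ha : a i ≠ 0) :
    ∃ r, Odd r ∧ i = deltaGcd n a * r := by
  obtain ⟨-, -, -, hQ, hs⟩ := h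
  obtain ⟨r, hr⟩ := deltaGcd_dvd_of_ne_zero hi ha
  refine ⟨r, odd_of_pow_add_one_dvd (Q := p ^ deltaGcd n a) (by omega) ?_, hr⟩
  rw [← pow_mul, ← hr]
  exact hs i (by simp [supportIdx, hi, ha])

theorem TechCond.dvd_half {p n m : ℕ} {F : Type*} [Field F] {a : ℕ → F}
    (h : TechCond p n m a) : deltaGcd n a ∣ m := by
  obtain ⟨hm, ⟨r, hr⟩, -⟩ := h
  have h1 := Nat.div_mul_cancel (deltaGcd_dvd n a)
  refine ⟨r, ?_⟩
  rw [hr] at h1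
  nlinarith

theorem TechCond.coeff_zero {p n m : ℕ} {F : Type*} [Field F] {a : ℕ → F}
    (h : TechCond p n m a) (hn : 0 < n) : a 0 = 0 := by
  by_contra ha
  obtain ⟨r, hr, h0⟩ := h.exists_odd hn ha
  rcases mul_eq_zero.mp h0.symm with h1 | h1
  · exact deltaGcd_ne_zero hn.ne' a h1
  · rw [h1] at hr
    exact absurd hr (by decide)

/-- Under the technical condition the kernel of `T_n` is a vector space over the field with
`p^{2δ}` elements. -/
theorem TechCond.even_of_numRoots_eq {p n m : ℕ} [Fact p.Prime] {F : Type*} [Field F] [Fintype F]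
    [Algebra (ZMod p) F] {a : ℕ → F} (h : TechCond p n m a) (hn : 0 < n)
    (hF : Fintype.card F = p ^ n) {α : F} {k : ℕ}
    (hk : numRoots p n a α = p ^ (deltaGcd n a * k)) : Even k := by
  have hd := deltaGcd_ne_zero hn.ne' a
  obtain ⟨t, ht⟩ := h.dvd_half
  have hn2 : n = 2 * deltaGcd n a * t := by rw [mul_assoc, ← ht]; exact h.1
  obtain ⟨j, hj⟩ : ∃ j, numRoots p n a α = p ^ (2 * deltaGcd n a * j) := by
    refine exists_numRoots_eq_pow p hF a α (by positivity) ⟨t, hn2⟩ ?_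
    intro u w hu hw
    rw [Tpoly_mul (v := u ^ p ^ deltaGcd n a) w (fun ha => absurd (h.coeff_zero hn) ha) ?_
      (Fact.out : p.Prime).ne_zero, hw, mul_zero]
    intro i hi ha
    rw [mem_Ico] at hi
    obtain ⟨r, hr, hir⟩ := h.exists_odd hi.2 ha
    have hsub : n - i = deltaGcd n a * (2 * t - r) := by
      rw [Nat.mul_sub, ← hir, ← mul_assoc, mul_comm _ 2, ← hn2]
    have hlt : r ≤ 2 * t := by
      have : deltaGcd n a * r < deltaGcd n a * (2 * t) := by
        rw [← hir, ← mul_assoc, mul_comm _ 2, ← hn2]; exact hi.2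
      exact (Nat.lt_of_mul_lt_mul_left this).le
    refine ⟨?_, ?_⟩
    · conv_lhs => rw [hir]
      exact pow_pow_mul_odd hu hr
    · rw [hsub]
      refine pow_pow_mul_odd hu ?_
      exact Nat.Even.sub_odd hlt (even_two_mul t) hr
  rw [hj] at hk
  have := Nat.pow_right_injective (Fact.out : p.Prime).two_le hk
  have h2 : deltaGcd n a * (2 * j) = deltaGcd n a * k := by rw [← this]; ring
  exact ⟨j, by rw [← Nat.eq_of_mul_eq_mul_left (Nat.pos_of_ne_zero hd) h2]; ring⟩

/-- `p^{2δ} - 1` divides `q - 1`; the cofactor `p^δ - 1` of `p^δ + 1` is even. -/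
theorem TechCond.two_mul_dvd {p n m : ℕ} (hp : Odd p) {F : Type*} [Field F] {a : ℕ → F}
    (h : TechCond p n m a) :
    2 * (p ^ deltaGcd n a + 1) ∣ p ^ n - 1 := by
  obtain ⟨t, ht⟩ := h.dvd_half
  have h1 : (p ^ deltaGcd n a) ^ 2 - 1 ∣ p ^ n - 1 := by
    have hn : p ^ n = ((p ^ deltaGcd n a) ^ 2) ^ t := by
      rw [← pow_mul, ← pow_mul, mul_left_comm, ← ht, ← h.1]
    rw [hn]
    have := Nat.sub_dvd_pow_sub_pow ((p ^ deltaGcd n a) ^ 2) 1 t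
    rwa [one_pow] at this
  refine dvd_trans ?_ h1
  obtain ⟨e, he⟩ := hp.pow (n := deltaGcd n a)
  rw [he]
  refine ⟨e, ?_⟩
  rw [Nat.sub_eq_iff_eq_add (Nat.one_le_pow _ _ (by omega))]
  ring

theorem exists_pow_eq_neg_one {F : Type*} [Field F] [Fintype F] {D : ℕ}
    (h : 2 * D ∣ Fintype.card F - 1) : ∃ u : Fˣ, u ^ D = -1 := by
  obtain ⟨g, hg⟩ := IsCyclic.exists_generator (α := Fˣ)
  obtain ⟨e, he⟩ := h
  obtain ⟨j, hj⟩ := Submonoid.mem_powers_iff _ _ |>.mp ((mem_powers_iff_mem_zpowers).mpr (hg (-1)))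
  have hord : orderOf g = 2 * D * e := by
    rw [orderOf_eq_card_of_forall_mem_zpowers hg, Nat.card_units, Nat.card_eq_fintype_card, he]
  have hcard : 1 < Fintype.card F := Fintype.one_lt_card
  have he0 : e ≠ 0 := by rintro rfl; omega
  have h1 : g ^ (j * (2 * e)) = 1 := by
    rw [pow_mul, hj, pow_mul, neg_one_sq, one_pow]
  have h2 := orderOf_dvd_of_pow_eq_one h1
  rw [hord, show 2 * D * e = D * (2 * e) by ring] at h2
  obtain ⟨k, rfl⟩ := Nat.dvd_of_mul_dvd_mul_right (by omega) h2
  exact ⟨g ^ k, by rw [← pow_mul, mul_comm, hj]⟩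

/-- Summing a function of `π x` over a finite group weights each value by the order of the
kernel. -/
theorem MonoidHom.sum_comp_eq_card_ker_mul {G H R : Type*} [Group G] [Group H] [Fintype G]
    [DecidableEq H] [CommSemiring R] (π : G →* H) (f : H → R) :
    ∑ x : G, f (π x) = Nat.card π.ker * ∑ y ∈ univ.image π, f y := by
  classical
  rw [← sum_fiberwise_of_maps_to (t := univ.image π) (g := π)
    (fun x _ => mem_image_of_mem _ (mem_univ x)), mul_sum]
  refine sum_congr rfl fun y hy => ?_
  obtain ⟨x₀, -, rfl⟩ := mem_image.mp hy
  rw [sum_congr rfl (g := fun _ => f (π x₀)) fun x hx => by rw [(mem_filter.mp hx).2], sum_const,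
    nsmul_eq_mul]
  congr 2
  rw [Nat.card_eq_fintype_card, ← Fintype.card_subtype]
  refine (Fintype.card_congr ((Equiv.mulLeft x₀).subtypeEquiv fun x => ?_)).symm
  simp [MonoidHom.mem_ker]

/-- `S_α ≡ 1` modulo `D`, as algebraic integers, when every exponent `p^i + 1` occurring in
`αxL(x)` is divisible by the divisor `D` of `q - 1`: on `Fˣ` the summand is then a function of
`x^D`, and the fibres of `x ↦ x^D` have `D` elements. -/
theorem exists_weilSum_eq_one_add_mul (p : ℕ) [Fact p.Prime] {F : Type*} [Field F] [Fintype F]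
    [Algebra (ZMod p) F] (n : ℕ) (a : ℕ → F) (α : F) {D : ℕ} (hD : D ∣ Fintype.card F - 1)
    (h : ∀ i < n, a i ≠ 0 → D ∣ p ^ i + 1) :
    ∃ A : ℂ, IsIntegral ℤ A ∧ weilSum p n a α = 1 + D * A := by
  classical
  let g : Fˣ → ℂ := fun y =>
    chiAddChar p F (∑ i ∈ range n, α * a i * (y : F) ^ ((p ^ i + 1) / D))
  refine ⟨∑ y ∈ univ.image (powMonoidHom D : Fˣ →* Fˣ), g y,
    IsIntegral.sum _ fun y _ => isIntegral_chiAddChar p _, ?_⟩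
  have hker : Nat.card (powMonoidHom D : Fˣ →* Fˣ).ker = D := by
    rw [IsCyclic.card_powMonoidHom_ker, Nat.card_units, Nat.card_eq_fintype_card,
      Nat.gcd_eq_right hD]
  have hsum := MonoidHom.sum_comp_eq_card_ker_mul (powMonoidHom D : Fˣ →* Fˣ) g
  rw [hker] at hsum
  rw [← hsum, weilSum, Fintype.sum_eq_add_sum_subtype_ne _ (0 : F),
    ← Equiv.sum_comp (unitsEquivNeZero (G₀ := F))]
  congr 1
  · simp [chiOne_eq_chiAddChar]
  · refine sum_congr rfl fun x _ => ?_
    rw [chiOne_eq_chiAddChar]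
    simp only [g, powMonoidHom_apply, Units.val_pow_eq_pow_val, unitsEquivNeZero_apply_coe]
    congr 1
    refine sum_congr rfl fun i hi => ?_
    by_cases ha : a i = 0
    · simp [ha]
    · rw [← pow_mul, Nat.mul_div_cancel' (h i (mem_range.mp hi) ha)]

/-- If `u^{p^i + 1} = -1` for every `i` in the support, then `x ↦ ux` carries the summands of `S_α`
to their conjugates, so `S_α` is real. -/
theorem conj_weilSum_eq_self (p : ℕ) [Fact p.Prime] {F : Type*} [Field F] [Fintype F]
    [Algebra (ZMod p) F] (n : ℕ) (a : ℕ → F) (α : F) (u : Fˣ)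
    (h : ∀ i < n, a i ≠ 0 → (u : F) ^ (p ^ i + 1) = -1) :
    (starRingEnd ℂ) (weilSum p n a α) = weilSum p n a α := by
  rw [weilSum, map_sum, ← Equiv.sum_comp (Units.mulLeft u) fun x : F =>
    chiOne p (∑ i ∈ range n, α * a i * x ^ (p ^ i + 1))]
  refine sum_congr rfl fun x _ => ?_
  rw [chiOne_eq_chiAddChar, chiOne_eq_chiAddChar, ← AddChar.map_neg_eq_conj, ← sum_neg_distrib]
  congr 1
  refine sum_congr rfl fun i hi => ?_
  by_cases ha : a i = 0
  · simp [ha]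
  · rw [Units.mulLeft_apply, mul_pow, h i (mem_range.mp hi) ha]
    ring

theorem TechCond.conj_weilSum {p n m : ℕ} [Fact p.Prime] (hp : Odd p) {F : Type*} [Field F]
    [Fintype F] [Algebra (ZMod p) F] {a : ℕ → F} (h : TechCond p n m a)
    (hF : Fintype.card F = p ^ n) (α : F) :
    (starRingEnd ℂ) (weilSum p n a α) = weilSum p n a α := by
  obtain ⟨u, hu⟩ := exists_pow_eq_neg_one (F := F) (D := p ^ deltaGcd n a + 1)
    (by rw [hF]; exact h.two_mul_dvd hp)
  have hu' : (u : F) ^ (p ^ deltaGcd n a + 1) = -1 := by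
    rw [← Units.val_pow_eq_pow_val, hu, Units.val_neg, Units.val_one]
  have hQ : Odd (p ^ deltaGcd n a) := hp.pow
  -- `u^{Q²-1} = (-1)^{Q-1} = 1`, so `u` lies in the field with `Q² = p^{2δ}` elements
  have hfix : (u : F) ^ p ^ (2 * deltaGcd n a) = u := by
    obtain ⟨e, he⟩ := hQ
    have h2 : p ^ (2 * deltaGcd n a) = (p ^ deltaGcd n a + 1) * (2 * e) + 1 := by
      rw [mul_comm, pow_mul, he]; ring
    rw [h2, pow_succ, pow_mul, hu', pow_mul, neg_one_sq, one_pow, one_mul]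
  refine conj_weilSum_eq_self p n a α u fun i hi ha => ?_
  obtain ⟨r, hr, hir⟩ := h.exists_odd hi ha
  rw [pow_succ, hir, pow_pow_mul_odd hfix hr, ← pow_succ, hu']

/-- A congruence modulo `D` between an integer and `1` in the ring of algebraic integers already
holds in `ℤ`. -/
theorem int_dvd_of_isIntegral {z : ℤ} {D : ℕ} (hD : D ≠ 0) {A : ℂ} (hA : IsIntegral ℤ A)
    (h : (z : ℂ) = 1 + D * A) : (D : ℤ) ∣ z - 1 := by
  have hD' : (D : ℂ) ≠ 0 := Nat.cast_ne_zero.mpr hD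
  have hA' : A = algebraMap ℚ ℂ ((z - 1) / D) := by
    rw [eq_ratCast]
    push_cast
    rw [h]
    field_simp
    ring
  rw [hA', isIntegral_algebraMap_iff (algebraMap ℚ ℂ).injective,
    IsIntegrallyClosed.isIntegral_iff] at hA
  obtain ⟨k, hk⟩ := hA
  refine ⟨k, ?_⟩
  have hDQ : (D : ℚ) ≠ 0 := Nat.cast_ne_zero.mpr hD
  rw [eq_div_iff hDQ] at hk
  have : ((z - 1 : ℤ) : ℚ) = ((D * k : ℤ) : ℚ) := by
    push_cast
    rw [← hk, eq_intCast]
    ring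
  exact_mod_cast this

theorem sign_eq_of_mul_pow_modEq_one {Q M : ℕ} (hQ : 2 < Q + 1) {μ : ℤ} (hμ : μ = 1 ∨ μ = -1)
    (h : ((Q + 1 : ℕ) : ℤ) ∣ μ * (Q : ℤ) ^ M - 1) : μ = (-1) ^ M := by
  have h1 : ((Q + 1 : ℕ) : ℤ) ∣ (Q : ℤ) ^ M - (-1) ^ M := by
    have := sub_dvd_pow_sub_pow (Q : ℤ) (-1) M
    push_cast
    simpa using this
  have h2 : ((Q + 1 : ℕ) : ℤ) ∣ μ * (-1) ^ M - 1 := by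
    have := dvd_sub h (h1.mul_left μ)
    rwa [show μ * (Q : ℤ) ^ M - 1 - μ * (Q ^ M - (-1) ^ M) = μ * (-1) ^ M - 1 by ring] at this
  have h3 : ¬ ((Q + 1 : ℕ) : ℤ) ∣ -2 := fun h => by
    rw [dvd_neg] at h
    have := Int.le_of_dvd (by norm_num) h
    omega
  rcases hμ with rfl | rfl <;> rcases neg_one_pow_eq_or ℤ M with hM | hM <;> rw [hM] at h2 ⊢
  · exact absurd (by simpa using h2) h3
  · exact absurd (by simpa using h2) h3

theorem exists_sign_mul_sqrt {z : ℂ} {r : ℝ} (hz : (starRingEnd ℂ) z = z)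
    (h : z * (starRingEnd ℂ) z = (r : ℂ)) :
    ∃ μ : ℤ, (μ = 1 ∨ μ = -1) ∧ z = (μ : ℂ) * ((√r : ℝ) : ℂ) := by
  obtain ⟨x, rfl⟩ := Complex.conj_eq_iff_real.mp hz
  rw [hz] at h
  have hx : x * x = r := by exact_mod_cast h
  rw [← hx, Real.sqrt_mul_self_eq_abs]
  rcases abs_choice x with h1 | h1
  · exact ⟨1, Or.inl rfl, by rw [h1]; simp⟩
  · exact ⟨-1, Or.inr rfl, by rw [h1]; simp⟩

/-- Under the technical condition `S_α = ±√(qN_α)`, and a sign with this property is determined: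
with `Q = p^δ` the equation reads `S_α = ±Q^{m/δ + γ/2}`, while `S_α ≡ 1` and `Q ≡ -1` modulo
`Q + 1 > 2`. -/
theorem TechCond.weilSum_eq {p n m : ℕ} [Fact p.Prime] (hp : Odd p) {F : Type*} [Field F]
    [Fintype F] [Algebra (ZMod p) F] {a : ℕ → F} (h : TechCond p n m a) (hn : 0 < n)
    (hF : Fintype.card F = p ^ n) {α : F} {k : ℕ}
    (hk : numRoots p n a α = p ^ (deltaGcd n a * k)) :
    weilSum p n a α = (((-1) ^ (m / deltaGcd n a + k / 2) : ℤ) : ℂ) *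
      ((√((p : ℝ) ^ n * (numRoots p n a α : ℝ)) : ℝ) : ℂ) := by
  obtain ⟨μ, hμ, hS⟩ := exists_sign_mul_sqrt (r := (p : ℝ) ^ n * (numRoots p n a α : ℝ))
    (h.conj_weilSum hp hF α) (by rw [weilSum_mul_conj p hp hn hF]; push_cast; rfl)
  have hd := Nat.pos_of_ne_zero (deltaGcd_ne_zero hn.ne' a)
  obtain ⟨j, hj⟩ := h.even_of_numRoots_eq hn hF hk
  obtain ⟨t, ht⟩ := h.dvd_half
  have hmt : m / deltaGcd n a = t := by rw [ht, Nat.mul_div_cancel_left _ hd]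
  have hkj : k / 2 = j := by omega
  have hsqrt : √((p : ℝ) ^ n * (numRoots p n a α : ℝ)) =
      ((p : ℝ) ^ deltaGcd n a) ^ (t + j) := by
    rw [Real.sqrt_eq_iff_mul_self_eq_of_pos (by
      have : 0 < p := (Fact.out : p.Prime).pos
      positivity), hk, hj]
    have hn2 : n = deltaGcd n a * t + deltaGcd n a * t := by rw [← ht, ← two_mul]; exact h.1
    conv_rhs => rw [show (p : ℝ) ^ n = p ^ (deltaGcd n a * t + deltaGcd n a * t) by rw [← hn2]]
    push_cast
    ring
  obtain ⟨A, hA, hSA⟩ := exists_weilSum_eq_one_add_mul p n a α (D := p ^ deltaGcd n a + 1)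
    (by rw [hF]; exact (Nat.dvd_mul_left _ 2).trans (h.two_mul_dvd hp))
    (fun i hi ha => h.2.2.2.2 i (by simp [supportIdx, hi, ha]))
  have hdvd := int_dvd_of_isIntegral (z := μ * ((p ^ deltaGcd n a : ℕ) : ℤ) ^ (t + j))
    (Nat.succ_ne_zero _) hA (by rw [← hSA, hS, hsqrt]; push_cast; rfl)
  have hQ := h.2.2.2.1
  rw [hS, hmt, hkj, sign_eq_of_mul_pow_modEq_one (by omega) hμ hdvd]

/-! ### Counting solutions of `xL(x) = -1` -/

/-- By orthogonality, `∑_α χ₁(α) S_α` counts the solutions of `xL(x) = -1` with weight `q`. -/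
theorem sum_chiOne_mul_weilSum (p : ℕ) [Fact p.Prime] {F : Type*} [Field F] [Fintype F]
    [Algebra (ZMod p) F] (n : ℕ) (a : ℕ → F) :
    ∑ α : F, chiOne p α * weilSum p n a α =
      Fintype.card F * (Nat.card {x : F // x * linPoly p n a x = -1} : ℂ) := by
  classical
  have h : ∀ α : F, chiOne p α * weilSum p n a α =
      ∑ x : F, chiAddChar p F (α * (1 + x * linPoly p n a x)) := by
    intro α
    rw [weilSum_eq, mul_sum]
    refine sum_congr rfl fun x _ => ?_
    rw [chiOne_eq_chiAddChar, ← AddChar.map_add_eq_mul, mul_add, mul_one]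
  rw [sum_congr rfl fun α _ => h α, sum_comm]
  simp only [sum_chiAddChar_mul]
  rw [← sum_filter, sum_const, nsmul_eq_mul, mul_comm, Nat.card_eq_fintype_card,
    Fintype.card_subtype]
  simp only [add_comm (1 : F), add_eq_zero_iff_eq_neg]

theorem cDDT_le_cUniformity {F : Type*} [Field F] [Fintype F] (G : F → F) {c : F} (hc : c ≠ 1)
    (a b : F) : cDDT G c a b ≤ cUniformity G c := by
  unfold cUniformity
  exact le_sup (f := fun ab : F × F => cDDT G c ab.1 ab.2) (b := (a, b)) (by simp [hc])

theorem cUniformity_le_card {F : Type*} [Field F] [Fintype F] (G : F → F) (c : F) :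
    cUniformity G c ≤ Fintype.card F :=
  Finset.sup_le fun ab _ => by
    rw [cDDT, ← Nat.card_eq_fintype_card]
    exact Finite.card_subtype_le _

/-- Every solution of `xL(x) = -1` is a nonzero root of `G`, hence is counted by the entry
`(0, 0)` of the `c`-difference distribution table. -/
theorem card_le_cUniformity (p n : ℕ) [Fact p.Prime] (hn : 1 < n) {F : Type*} [Field F]
    [Fintype F] (hF : Fintype.card F = p ^ n) {c : F} (hc : c ≠ 1) (a : ℕ → F) :
    Nat.card {x : F // x * linPoly p n a x = -1} ≤ cUniformity (perturbedInverse p n a) c := by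
  refine le_trans ?_ (cDDT_le_cUniformity _ hc 0 0)
  refine Nat.card_le_card_of_injective
    (fun x => ⟨x.1, ?_⟩) fun x y hxy => Subtype.ext (by simpa using hxy)
  obtain ⟨x, hx⟩ := x
  have hx0 : x ≠ 0 := by rintro rfl; simp at hx
  have h4 : 2 ≤ p ^ n := (Fact.out : p.Prime).two_le.trans (Nat.le_self_pow (by omega) p)
  have hroot : perturbedInverse p n a x = 0 := by
    apply (mul_eq_zero.mp _).resolve_left hx0
    have : x * x ^ (p ^ n - 2) = 1 := by
      rw [← pow_succ', show p ^ n - 2 + 1 = p ^ n - 1 by omega, ← hF,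
        FiniteField.pow_card_sub_one_eq_one x hx0]
    rw [perturbedInverse, mul_add, this, hx, add_neg_cancel]
  simp [hroot]

theorem numRoots_zero (p n : ℕ) [Fact p.Prime] {F : Type*} [Field F] [Fintype F] (a : ℕ → F) :
    numRoots p n a 0 = Fintype.card F := by
  have h : ∀ w : F, Tpoly p n a 0 w = 0 := fun w => by
    simp [Tpoly, (Fact.out : p.Prime).ne_zero]
  simp [numRoots, h, Nat.card_eq_fintype_card]

theorem maxRoots_eq_card (p n : ℕ) [Fact p.Prime] {F : Type*} [Field F] [Fintype F] (a : ℕ → F) :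
    maxRoots p n a = Fintype.card F := by
  refine le_antisymm (Finset.sup_le fun α _ => ?_) ?_
  · rw [numRoots, ← Nat.card_eq_fintype_card]
    exact Finite.card_subtype_le _
  · rw [← numRoots_zero p n a]
    exact le_sup (mem_univ 0)

/-! ### Bounds for the `c`-differential uniformity -/

open Classical in
theorem mainTheorem4 (p n : ℕ) [Fact p.Prime] (hp : Odd p) (hn : 4 ≤ n)
    {F : Type*} [Field F] [Fintype F] [Algebra (ZMod p) F] (hF : Fintype.card F = p ^ n)
    (c : F) (hc : c ≠ 1) (a : ℕ → F) :
    (cUniformity (perturbedInverse p n a) c : ℝ) ≤ √((p : ℝ) ^ n * (maxRoots p n a : ℝ)) ∧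
    (cUniformity (perturbedInverse p n a) c : ℝ)
      ≤ ((p : ℝ) * (maxRoots p n a : ℝ)) ^ ((n : ℝ) / 2) ∧
    ∃ γ : F → ℕ,
      (∀ α : F, numRoots p n a α = p ^ (deltaGcd n a * γ α)) ∧
      ∀ m : ℕ, TechCond p n m a →
        (∃ μ : F → ℤ,
          (∀ α : F, (μ α = 1 ∨ μ α = -1) ∧
            weilSum p n a α = (μ α : ℂ) * ((√((p : ℝ) ^ n * (numRoots p n a α : ℝ)) : ℝ) : ℂ)) ∧
          1 / (p : ℂ) ^ n * ∑ α : F, chiOne p α * (μ α : ℂ) *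
              (((p : ℝ) ^ (((deltaGcd n a * γ α : ℕ) : ℝ) / 2) : ℝ) : ℂ)
            ≤ (cUniformity (perturbedInverse p n a) c : ℂ)) ∧
        (∀ α : F, Even (γ α)) ∧
        (-1 : ℂ) ^ (m / deltaGcd n a) * ((p : ℂ) ^ m)⁻¹ *
            ∑ α ∈ (Finset.univ : Finset F).filter (fun α => numRoots p n a α = 1), chiOne p α
          + (-1 : ℂ) ^ (m / deltaGcd n a) * ((p : ℂ) ^ m)⁻¹ *
            ∑ α ∈ (Finset.univ : Finset F).filter (fun α => 1 < numRoots p n a α),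
              chiOne p α * (-1 : ℂ) ^ (γ α / 2) *
                (((p : ℝ) ^ (((deltaGcd n a * γ α : ℕ) : ℝ) / 2) : ℝ) : ℂ)
          ≤ (cUniformity (perturbedInverse p n a) c : ℂ) := by
  have hn0 : 0 < n := by omega
  have hppos : 0 < p := (Fact.out : p.Prime).pos
  have hpR : (0 : ℝ) < p := Nat.cast_pos.mpr hppos
  have hmax : (maxRoots p n a : ℝ) = (p : ℝ) ^ n := by
    rw [maxRoots_eq_card, hF, Nat.cast_pow]
  have hcard : (cUniformity (perturbedInverse p n a) c : ℝ) ≤ (p : ℝ) ^ n := by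
    have := cUniformity_le_card (perturbedInverse p n a) c
    rw [hF] at this
    exact_mod_cast this
  refine ⟨?_, ?_, ?_⟩
  · rw [hmax, Real.sqrt_mul_self (by positivity)]
    exact hcard
  · -- `(p · pⁿ)^{n/2} ≥ (p²)^{n/2} = pⁿ`
    rw [hmax]
    refine hcard.trans ?_
    have h1 : (p : ℝ) ^ n = ((p : ℝ) ^ 2) ^ ((n : ℝ) / 2) := by
      rw [← Real.rpow_natCast, ← Real.rpow_natCast, ← Real.rpow_mul hpR.le]
      congr 1
      push_cast
      ring
    conv_lhs => rw [h1]
    refine Real.rpow_le_rpow (by positivity) ?_ (by positivity)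
    rw [← pow_succ']
    exact pow_le_pow_right₀ (by exact_mod_cast hppos) (by omega)
  · choose γ hγ using exists_numRoots_eq_pow_deltaGcd p hn0.ne' hF a
    refine ⟨γ, hγ, fun m h => ?_⟩
    set v := Nat.card {x : F // x * linPoly p n a x = -1} with hv
    set δ := deltaGcd n a with hδ
    have hvle : v ≤ cUniformity (perturbedInverse p n a) c :=
      card_le_cUniformity p n (by omega) hF hc a
    have hpm : ((p : ℂ) ^ m) ≠ 0 := pow_ne_zero _ (Nat.cast_ne_zero.mpr hppos.ne')
    have hn2 : (p : ℂ) ^ n = (p : ℂ) ^ m * (p : ℂ) ^ m := by rw [← pow_add, ← two_mul, ← h.1]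
    have hsqrt : ∀ α : F, √((p : ℝ) ^ n * (numRoots p n a α : ℝ)) =
        (p : ℝ) ^ m * (p : ℝ) ^ (((δ * γ α : ℕ) : ℝ) / 2) := by
      intro α
      rw [Real.sqrt_eq_iff_mul_self_eq_of_pos (by positivity), mul_mul_mul_comm, ← pow_add,
        ← Real.rpow_add hpR, add_halves, Real.rpow_natCast, ← two_mul, ← h.1, hγ α]
      push_cast
      rfl
    have hsum : ∑ α : F, chiOne p α * (((-1) ^ (m / δ + γ α / 2) : ℤ) : ℂ) *
        (((p : ℝ) ^ (((δ * γ α : ℕ) : ℝ) / 2) : ℝ) : ℂ) = (p : ℂ) ^ m * v := by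
      have h1 := sum_chiOne_mul_weilSum p n a
      rw [hF, Nat.cast_pow, hn2, mul_assoc] at h1
      apply mul_left_cancel₀ hpm
      rw [← h1, mul_sum]
      refine sum_congr rfl fun α _ => ?_
      rw [h.weilSum_eq hp hn0 hF (hγ α), hsqrt α]
      push_cast
      ring
    refine ⟨⟨fun α => (-1) ^ (m / δ + γ α / 2), fun α => ⟨neg_one_pow_eq_or ℤ _,
      h.weilSum_eq hp hn0 hF (hγ α)⟩, ?_⟩,
      fun α => h.even_of_numRoots_eq hn0 hF (hγ α), ?_⟩
    · -- the left-hand side is the number of solutions divided by `p^m`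
      rw [hsum, hn2, show 1 / ((p : ℂ) ^ m * (p : ℂ) ^ m) * ((p : ℂ) ^ m * v) =
        ((v / (p : ℝ) ^ m : ℝ) : ℂ) by push_cast; field_simp]
      have hle : (v / (p : ℝ) ^ m : ℝ) ≤ cUniformity (perturbedInverse p n a) c :=
        (div_le_self (Nat.cast_nonneg v) (one_le_pow₀ (by exact_mod_cast hppos))).trans
          (by exact_mod_cast hvle)
      exact_mod_cast Complex.real_le_real.mpr hle
    · -- the left-hand side is the number of solutions
      have hone : ∀ α ∈ univ.filter (fun α : F => numRoots p n a α = 1), chiOne p α =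
          chiOne p α * (-1 : ℂ) ^ (γ α / 2) *
            (((p : ℝ) ^ (((δ * γ α : ℕ) : ℝ) / 2) : ℝ) : ℂ) := by
        intro α hα
        rw [mem_filter, hγ α] at hα
        have h0 : δ * γ α = 0 := by
          exact (Nat.pow_eq_one.mp hα.2).resolve_left (Fact.out : p.Prime).one_lt.ne'
        have h1 : γ α = 0 := (mul_eq_zero.mp h0).resolve_left (deltaGcd_ne_zero hn0.ne' a)
        simp [h1]
      have hfilter : univ.filter (fun α : F => 1 < numRoots p n a α) =
          univ.filter (fun α : F => ¬ numRoots p n a α = 1) := by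
        refine filter_congr fun α _ => ?_
        have : 0 < numRoots p n a α := by rw [hγ α]; positivity
        omega
      rw [sum_congr rfl hone, hfilter, ← mul_add, sum_filter_add_sum_filter_not]
      have heq : (-1 : ℂ) ^ (m / δ) * ((p : ℂ) ^ m)⁻¹ *
          ∑ α : F, chiOne p α * (-1 : ℂ) ^ (γ α / 2) *
            (((p : ℝ) ^ (((δ * γ α : ℕ) : ℝ) / 2) : ℝ) : ℂ) = v := by
        rw [mul_right_comm, mul_sum, mul_inv_eq_iff_eq_mul₀ hpm, mul_comm (v : ℂ), ← hsum]
        refine sum_congr rfl fun α _ => ?_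
        push_cast
        ring
      rw [heq]
      exact_mod_cast hvle
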